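/- Let $M$ be a real-analytic manifold of dimension three, $L$ an analytic field of endomorphisms of its tangent spaces and $e$ an analytic vector field on $M$, such that $(L,e)$ is a Nijenhuis operator with a unity, that is, $$[L\xi,L\eta]+L^2[\xi,\eta]-L[L\xi,\eta]-L[\xi,L\eta]=0,\qquad \mathcal L_e L=\operatorname{Id}$$ for all vector fields $\xi,\eta$. Let $p_0\in M$, and suppose that near $p_0$ there are analytic coordinates $(x^1,x^2,x^3)$, all vanishing at $p_0$, in which $(L,e)$ has the semi-normal form $$e=\frac{\partial}{\partial x^1},\qquad L=\begin{pmatrix} x^1+\lambda_0&0&0\\ \frac{x^2}{k}&\varepsilon (x^2)^k+x^1+\lambda_0&0\\ f(x^2,x^3)&g(x^2,x^3)&\varepsilon (x^2)^k+x^1+\lambda_0\end{pmatrix},$$ where $k\ge 1$ is an integer, $\varepsilon\in\{1,-1\}$, $\lambda_0\in\mathbb R$, and $f,g$ are analytic functions near $(0,0)$. (Thus $L$ has two distinct eigenvalues at generic points near $p_0$ and the single eigenvalue $\lambda_0$ at $p_0$.) Assume that $g(0,0)\neq 0$ and, if $k=1$, also that $f(0,0)=0$. Then there exists an analytic coordinate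 system $(x^1,x^2,x^3)$ in a neighbourhood of $p_0$ in which, with the same $k,\varepsilon,\lambda_0$, $$e=\frac{\partial}{\partial x^1},\qquad L=\begin{pmatrix} x^1+\lambda_0&0&0\\ \frac{x^2}{k}&\varepsilon (x^2)^k+x^1+\lambda_0&0\\ \frac{1-k}{k}x^3&1&\varepsilon (x^2)^k+x^1+\lambda_0\end{pmatrix},$$ so that the normal form contains no functional parameters. These coordinates can be chosen so that $x^1(p_0)=x^2(p_0)=0$ and, if $f(0,0)=0$, also $x^3(p_0)=0$. -/

import Mathlib

open scoped Manifold ContDiff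

/-- The space of values of a coordinate system `(x¹, x², x³)`; the coordinates are indexed
by `0, 1, 2 : Fin 3`. -/
abbrev Coord3 : Type := EuclideanSpace ℝ (Fin 3)

section

variable {M : Type*} [TopologicalSpace M] [ChartedSpace Coord3 M]

/-- The vector field `ξ` is analytic at `p`, that is, in a neighbourhood of `p`. -/
def VectorFieldAnalyticAt [IsManifold (𝓡 3) ω M] (ξ : (p : M) → TangentSpace (𝓡 3) p)
    (p : M) : Prop :=
  ContMDiffAt (𝓡 3) (𝓡 3).tangent ω (fun q => (⟨q, ξ q⟩ : TangentBundle (𝓡 3) M)) p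

/-- The operator field (field of endomorphisms of the tangent spaces) `L` is analytic, as a
section of the bundle `Hom(TM, TM)`. -/
def OperatorFieldAnalytic [IsManifold (𝓡 3) ω M]
    (L : (p : M) → TangentSpace (𝓡 3) p →L[ℝ] TangentSpace (𝓡 3) p) : Prop :=
  ContMDiff (𝓡 3) ((𝓡 3).prod 𝓘(ℝ, Coord3 →L[ℝ] Coord3)) ω
    (fun p => Bundle.TotalSpace.mk' (Coord3 →L[ℝ] Coord3)
      (E := fun q : M => TangentSpace (𝓡 3) q →L[ℝ] TangentSpace (𝓡 3) q) p (L p))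

/-- The Nijenhuis torsion
`N_L(ξ, η) = [Lξ, Lη] + L²[ξ, η] - L[Lξ, η] - L[ξ, Lη]` at the point `p`. -/
noncomputable def nijenhuisTorsion
    (L : (p : M) → TangentSpace (𝓡 3) p →L[ℝ] TangentSpace (𝓡 3) p)
    (ξ η : (p : M) → TangentSpace (𝓡 3) p) (p : M) : TangentSpace (𝓡 3) p :=
  VectorField.mlieBracket (𝓡 3) (fun q => L q (ξ q)) (fun q => L q (η q)) p
    + L p (L p (VectorField.mlieBracket (𝓡 3) ξ η p))
    - L p (VectorField.mlieBracket (𝓡 3) (fun q => L q (ξ q)) η p)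
    - L p (VectorField.mlieBracket (𝓡 3) ξ (fun q => L q (η q)) p)

/-- The Lie derivative of an operator field `L` along `e`, applied to a vector field `ξ`:
`(𝓛_e L) ξ = [e, Lξ] - L[e, ξ]` at the point `p`. -/
noncomputable def lieDerivOperator (e : (p : M) → TangentSpace (𝓡 3) p)
    (L : (p : M) → TangentSpace (𝓡 3) p →L[ℝ] TangentSpace (𝓡 3) p)
    (ξ : (p : M) → TangentSpace (𝓡 3) p) (p : M) : TangentSpace (𝓡 3) p :=
  VectorField.mlieBracket (𝓡 3) e (fun q => L q (ξ q)) p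
    - L p (VectorField.mlieBracket (𝓡 3) e ξ p)

/-- `(L, e)` is a Nijenhuis operator with a unity, in the analytic category: `N_L = 0` and
`𝓛_e L = Id`. Both identities are between tensors; they are tested, at each point, on
vector fields that are defined and analytic near that point. -/
structure IsNijenhuisWithUnity [IsManifold (𝓡 3) ω M]
    (L : (p : M) → TangentSpace (𝓡 3) p →L[ℝ] TangentSpace (𝓡 3) p)
    (e : (p : M) → TangentSpace (𝓡 3) p) : Prop where
  analytic_operator : OperatorFieldAnalytic L
  analytic_unity : ∀ p, VectorFieldAnalyticAt e p
  torsion_eq_zero : ∀ (p : M) (ξ η : (q : M) → TangentSpace (𝓡 3) q),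
    VectorFieldAnalyticAt ξ p → VectorFieldAnalyticAt η p → nijenhuisTorsion L ξ η p = 0
  lieDeriv_eq_id : ∀ (p : M) (ξ : (q : M) → TangentSpace (𝓡 3) q),
    VectorFieldAnalyticAt ξ p → lieDerivOperator e L ξ p = ξ p

/-- The differential at `p` of a coordinate system `φ`: it sends a tangent vector to the
column of its components with respect to `∂/∂x¹, ∂/∂x², ∂/∂x³`. -/
noncomputable def coordDiff (φ : OpenPartialHomeomorph M Coord3) (p : M) :
    TangentSpace (𝓡 3) p →L[ℝ] Coord3 :=
  mfderiv (𝓡 3) (𝓡 3) φ p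

/-- On the whole domain of the coordinate system `φ`, `e = ∂/∂x¹` and `L` has the matrix
`A(x¹, x², x³)` (acting on columns of components). -/
def HasCoordForm (L : (p : M) → TangentSpace (𝓡 3) p →L[ℝ] TangentSpace (𝓡 3) p)
    (e : (p : M) → TangentSpace (𝓡 3) p) (φ : OpenPartialHomeomorph M Coord3)
    (A : Coord3 → Matrix (Fin 3) (Fin 3) ℝ) : Prop :=
  ∀ p ∈ φ.source,
    coordDiff φ p (e p) = EuclideanSpace.single 0 1 ∧
    ∀ v : TangentSpace (𝓡 3) p,
      coordDiff φ p (L p v) = Matrix.toEuclideanLin (A (φ p)) (coordDiff φ p v)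

end

/-- The matrix of the semi-normal form with parameters `k`, `lam0`, the sign `ε = ±1` and the
functions `f(x², x³)`, `g(x², x³)`. -/
noncomputable def semiNormalMatrix (ε : ℝ) (k : ℕ) (lam0 : ℝ) (f g : ℝ × ℝ → ℝ)
    (x : Coord3) : Matrix (Fin 3) (Fin 3) ℝ :=
  !![x 0 + lam0, 0, 0;
     x 1 / k, ε * x 1 ^ k + x 0 + lam0, 0;
     f (x 1, x 2), g (x 1, x 2), ε * x 1 ^ k + x 0 + lam0]

/-! Keep `x¹, x²` and replace `x³` by a function `Z(x², x³)`. Comparing third rows, `Z` brings `L`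
to the normal form iff `g Z₃ = 1` and `x² Z₂ + k f Z₃ = (1 - k) Z`. This is an overdetermined
system, and its compatibility condition is the vanishing of the torsion
(`semiNormalMatrix_structural_equation`).

Eliminating `f` and `g` from the coefficients gives a single equation for the Euler field `D = x² ∂₂
+ x³ ∂₃`, namely `D Z + (k - 1) Z = (x³ - k f) / g`. It is solved by dividing the degree `n` part of
the right side by `n + k - 1` (`exists_analyticAt_euler_add_smul_eq`). Only `n = 0`, `k = 1` is
obstructed, and there `f (0, 0) = 0` removes the obstruction.

Conversely, the torsion equation shows that `u = Z₃ - 1 / g` satisfies `D u + k u = 0`, hence `u =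
0` (`eventually_eq_zero_of_euler_add_smul_eq_zero`), and both original equations follow. Since `Z₃ ≠
0`, the inverse function theorem makes `(x¹, x², Z)` a chart. -/

open Filter Topology

/-! ### Equations for the Euler vector field. -/

section EulerOperator

variable {E : Type*} [NormedAddCommGroup E] [NormedSpace ℝ E]

/-- The equation `D Z + a Z = F`, where `D` is the Euler vector field, has an analytic solution
near the origin unless `a = 0` and `F 0 ≠ 0`. -/
theorem exists_analyticAt_euler_add_smul_eq {F : E → ℝ} (hF : AnalyticAt ℝ F 0) (a : ℕ)
    (ha : a = 0 → F 0 = 0) :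
    ∃ Z : E → ℝ, AnalyticAt ℝ Z 0 ∧ (F 0 = 0 → Z 0 = 0) ∧
      ∀ᶠ x in 𝓝 0, fderiv ℝ Z x x + a * Z x = F x := by
  obtain ⟨p, r, hp⟩ := hF
  -- `D` multiplies degree `n` terms by `n`. If `n = a = 0`, the convention `0⁻¹ = 0` makes the
  -- constant term zero, which is correct because then `F 0 = 0`.
  let q : FormalMultilinearSeries ℝ E ℝ := fun n => ((n + a : ℝ)⁻¹) • p n
  have hp0 : ∀ v : Fin 0 → E, p 0 v = F 0 := hp.coeff_zero
  have hpq : p.radius ≤ q.radius := by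
    refine FormalMultilinearSeries.radius_le_of_le fun n => ?_
    simp only [q, norm_smul, norm_inv]
    refine mul_le_of_le_one_left (norm_nonneg _) ?_
    rcases Nat.eq_zero_or_pos (n + a) with h | h
    · have : (n + a : ℝ) = 0 := by exact_mod_cast h
      simp [this]
    · have : (1 : ℝ) ≤ n + a := by exact_mod_cast h
      exact inv_le_one_of_one_le₀ (this.trans (le_abs_self _))
  have hq : HasFPowerSeriesOnBall q.sum q 0 r :=
    (q.hasFPowerSeriesOnBall (hp.r_pos.trans_le (hp.r_le.trans hpq))).mono hp.r_pos
      (hp.r_le.trans hpq)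
  refine ⟨q.sum, hq.analyticAt, fun h0 => ?_, ?_⟩
  · rw [← hq.coeff_zero 0]
    simp [q, hp0, h0]
  · filter_upwards [Metric.eball_mem_nhds (0 : E) hp.r_pos] with x hx
    have h1 := hq.fderiv.hasSum hx
    have h2 := h1.mapL (ContinuousLinearMap.apply ℝ ℝ x)
    simp only [zero_add, ContinuousLinearMap.apply_apply,
      FormalMultilinearSeries.derivSeries_apply_diag] at h2
    -- The derivative series starts at degree one; the shift is harmless because the term `n = 0`
    -- vanishes.
    have h3 : HasSum (fun n : ℕ => n • q n fun _ => x) (fderiv ℝ q.sum x x) := by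
      rw [← hasSum_nat_add_iff' 1]
      simpa using h2
    have h4 := (h3.add ((hq.hasSum hx).mul_left (a : ℝ)))
    have h5 := hp.hasSum hx
    simp only [zero_add] at h4 h5
    refine h4.unique ?_
    suffices hpn : ∀ n : ℕ, (n • q n fun _ => x) + (a : ℝ) * (q n fun _ => x) = p n fun _ => x by
      simpa only [hpn] using h5
    intro n
    simp only [q, smul_apply, smul_eq_mul, nsmul_eq_mul]
    rw [← add_mul, ← mul_assoc]
    rcases Nat.eq_zero_or_pos (n + a) with h | h
    · obtain ⟨rfl, rfl⟩ : n = 0 ∧ a = 0 := by omega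
      simp [hp0, ha rfl]
    · have : (n + a : ℝ) ≠ 0 := by exact_mod_cast h.ne'
      rw [mul_inv_cancel₀ this, one_mul]

/-- For `k ≥ 1`, the equation `D u + k u = 0` has only the trivial solution near the origin. -/
theorem eventually_eq_zero_of_euler_add_smul_eq_zero {u : E → ℝ} {k : ℕ} (hk : 1 ≤ k)
    (hu : ∀ᶠ x in 𝓝 0, DifferentiableAt ℝ u x)
    (h : ∀ᶠ x in 𝓝 0, fderiv ℝ u x x + k * u x = 0) : ∀ᶠ x in 𝓝 0, u x = 0 := by
  obtain ⟨r, hr, hball⟩ := Metric.eventually_nhds_iff_ball.1 (hu.and h)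
  filter_upwards [Metric.ball_mem_nhds (0 : E) hr] with x hx
  have hmem : ∀ t ∈ Set.Icc (0 : ℝ) 1, t • x ∈ Metric.ball (0 : E) r := by
    intro t ht
    rw [mem_ball_zero_iff] at hx ⊢
    rw [norm_smul, Real.norm_of_nonneg ht.1]
    exact (mul_le_of_le_one_left (norm_nonneg _) ht.2).trans_lt hx
  -- Along the ray through `x` the derivative of `t ^ k * u (t • x)` is `t ^ (k - 1) * (D u + k u)
  -- (t • x)`. The function is therefore constant, and it vanishes at `t = 0` because `k ≥ 1`.
  have hd : ∀ t ∈ Set.Icc (0 : ℝ) 1, HasDerivAt (fun t : ℝ => t ^ k * u (t • x)) 0 t := by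
    intro t ht
    obtain ⟨h1, h2⟩ := hball _ (hmem t ht)
    have h3 : HasDerivAt (fun t : ℝ => u (t • x)) (fderiv ℝ u (t • x) x) t := by
      simpa using! h1.hasFDerivAt.comp_hasDerivAt t ((hasDerivAt_id t).smul_const x)
    refine ((hasDerivAt_pow k t).mul h3).congr_deriv ?_
    rw [map_smul, smul_eq_mul] at h2
    obtain ⟨j, rfl⟩ : ∃ j, k = j + 1 := ⟨k - 1, by omega⟩
    rw [Nat.add_sub_cancel, pow_succ]
    linear_combination t ^ j * h2
  have hc := constant_of_has_deriv_right_zero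
    (f := fun t : ℝ => t ^ k * u (t • x)) (a := 0) (b := 1)
    (fun t ht => (hd t ht).continuousAt.continuousWithinAt)
    (fun t ht => (hd t (Set.Ico_subset_Icc_self ht)).hasDerivWithinAt) 1 (by simp)
  simpa [Nat.one_le_iff_ne_zero.1 hk] using hc

end EulerOperator

/-! ### The rectifying function `Z` in the plane. -/

theorem apply_eq_partials (T : ℝ × ℝ →L[ℝ] ℝ) (a b : ℝ) :
    T (a, b) = a * T (1, 0) + b * T (0, 1) := by
  rw [show ((a, b) : ℝ × ℝ) = a • (1, 0) + b • (0, 1) by simp, map_add, map_smul, map_smul,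
    smul_eq_mul, smul_eq_mul]

/-- The vector fields `X = (y / k) ∂_y + f ∂_z` and `Y = g ∂_z` in the plane with
`[X, Y] = (1 - 1 / k) Y` and `g (0, 0) ≠ 0` admit an analytic function `Z` with `Y Z = 1` and
`X Z = ((1 - k) / k) Z`. -/
theorem exists_analyticAt_rectifying {f g : ℝ × ℝ → ℝ} {k : ℕ} (hk : 1 ≤ k)
    (hf : AnalyticAt ℝ f (0, 0)) (hg : AnalyticAt ℝ g (0, 0)) (hg₀ : g (0, 0) ≠ 0)
    (hf₀ : k = 1 → f (0, 0) = 0)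
    (hfg : ∀ᶠ x : ℝ × ℝ in 𝓝 (0, 0), x.1 * fderiv ℝ g x (1, 0) +
      k * (f x * fderiv ℝ g x (0, 1) - g x * fderiv ℝ f x (0, 1)) + (1 - k) * g x = 0) :
    ∃ Z : ℝ × ℝ → ℝ, AnalyticAt ℝ Z (0, 0) ∧ (f (0, 0) = 0 → Z (0, 0) = 0) ∧
      ∀ᶠ x : ℝ × ℝ in 𝓝 (0, 0), g x * fderiv ℝ Z x (0, 1) = 1 ∧
        x.1 * fderiv ℝ Z x (1, 0) + k * f x * fderiv ℝ Z x (0, 1) = (1 - k) * Z x := by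
  -- Substituting `Z₃ = 1 / g` in the second equation and adding `x.2 * Z₃ = x.2 / g` yields `D Z +
  -- m Z = H`.
  obtain ⟨m, rfl⟩ : ∃ m, k = m + 1 := ⟨k - 1, by omega⟩
  set H : ℝ × ℝ → ℝ := fun x => (x.2 - (m + 1 : ℕ) * f x) * (g x)⁻¹ with hH
  have hHa : AnalyticAt ℝ H (0, 0) :=
    (analyticAt_snd.sub (analyticAt_const.mul hf)).mul (hg.inv hg₀)
  have hH0 : f (0, 0) = 0 → H (0, 0) = 0 := fun h => by simp [hH, h]
  obtain ⟨Z, hZ, hZ0, hZe⟩ := exists_analyticAt_euler_add_smul_eq hHa m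
    (fun h => hH0 (hf₀ (by omega)))
  refine ⟨Z, hZ, fun h => hZ0 (hH0 h), ?_⟩
  have hgne : ∀ᶠ x in 𝓝 ((0, 0) : ℝ × ℝ), g x ≠ 0 := hg.continuousAt.eventually_ne hg₀
  set u : ℝ × ℝ → ℝ := fun x => fderiv ℝ Z x (0, 1) - (g x)⁻¹ with hu
  have hinv : ∀ x, DifferentiableAt ℝ g x → g x ≠ 0 →
      HasFDerivAt (fun x => (g x)⁻¹) (-(g x ^ 2)⁻¹ • fderiv ℝ g x) x := fun x h1 h2 =>
    (hasDerivAt_inv h2).comp_hasFDerivAt x h1.hasFDerivAt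
  have hud : ∀ᶠ x in 𝓝 ((0, 0) : ℝ × ℝ), HasFDerivAt u
      ((ContinuousLinearMap.apply ℝ ℝ ((0, 1) : ℝ × ℝ)).comp (fderiv ℝ (fderiv ℝ Z) x) -
        (-(g x ^ 2)⁻¹ • fderiv ℝ g x)) x := by
    filter_upwards [hgne, hg.eventually_analyticAt, hZ.fderiv.eventually_analyticAt]
      with x h1 h2 h3
    exact ((ContinuousLinearMap.apply ℝ ℝ ((0, 1) : ℝ × ℝ)).hasFDerivAt.comp x
      h3.differentiableAt.hasFDerivAt).sub (hinv x h2.differentiableAt h1)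
  have hu0 : ∀ᶠ x in 𝓝 ((0, 0) : ℝ × ℝ), u x = 0 := by
    refine eventually_eq_zero_of_euler_add_smul_eq_zero hk
      (hud.mono fun x h => h.differentiableAt) ?_
    filter_upwards [hud, hgne, hg.eventually_analyticAt, hf.eventually_analyticAt,
      hZ.eventually_analyticAt, hZ.fderiv.eventually_analyticAt, hZe.eventually_nhds, hfg]
      with x h1 h2 h3 h4 h5 h6 h7 h8
    have hL : HasFDerivAt (fun x => fderiv ℝ Z x x + m * Z x)
        ((fderiv ℝ Z x).comp (ContinuousLinearMap.id ℝ _) +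
          (fderiv ℝ (fderiv ℝ Z) x).flip x + (m : ℝ) • fderiv ℝ Z x) x :=
      (h6.differentiableAt.hasFDerivAt.clm_apply (hasFDerivAt_id x)).add
        (h5.differentiableAt.hasFDerivAt.const_mul _)
    have hR : HasFDerivAt H ((x.2 - (m + 1 : ℕ) * f x) • (-(g x ^ 2)⁻¹ • fderiv ℝ g x) +
        (g x)⁻¹ • (ContinuousLinearMap.snd ℝ ℝ ℝ - ((m + 1 : ℕ) : ℝ) • fderiv ℝ f x)) x :=
      (hasFDerivAt_snd.sub (h4.differentiableAt.hasFDerivAt.const_mul _)).mul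
        (hinv x h3.differentiableAt h2)
    -- Differentiating the Euler equation along `(0, 1)` gives `D Z₃ + k Z₃ = ∂H/∂z`; by `hfg`, `1 /
    -- g` satisfies the same equation.
    have hLR := (hL.congr_of_eventuallyEq (EventuallyEq.symm h7)).unique hR
    have hv := congrArg (fun T : ℝ × ℝ →L[ℝ] ℝ => T (0, 1)) hLR
    have hsymm := (h5.contDiffAt (n := ω)).isSymmSndFDerivAt (by simp) (0, 1) x
    rw [h1.fderiv]
    simp only [hu, add_apply, sub_apply,
      smul_apply, ContinuousLinearMap.comp_apply, smul_eq_mul,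
      ContinuousLinearMap.flip_apply, ContinuousLinearMap.id_apply,
      ContinuousLinearMap.apply_apply, ContinuousLinearMap.coe_snd'] at hv ⊢
    rw [hsymm] at hv
    rw [apply_eq_partials (fderiv ℝ g x) x.1 x.2]
    push_cast at hv h8 ⊢
    have hi : g x * (g x)⁻¹ = 1 := mul_inv_cancel₀ h2
    rw [← inv_pow] at hv ⊢
    generalize (g x)⁻¹ = G at *
    have e1 : g x * G ^ 2 = G := by linear_combination G * hi
    linear_combination hv + G ^ 2 * h8 + (m + (m + 1) * fderiv ℝ f x (0, 1)) * e1
  filter_upwards [hu0, hgne, hZe] with x h1 h2 h3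
  have h4 : fderiv ℝ Z x (0, 1) = (g x)⁻¹ := sub_eq_zero.1 h1
  refine ⟨by rw [h4, mul_inv_cancel₀ h2], ?_⟩
  rw [apply_eq_partials (fderiv ℝ Z x) x.1 x.2, h4] at h3
  rw [h4]
  simp only [hH] at h3
  push_cast at h3 ⊢
  linear_combination h3

/-! ### Brackets and torsion in a chart. -/

section CoordinateExpressions

open VectorField

variable {M : Type*} [TopologicalSpace M] [ChartedSpace Coord3 M]
  {φ : OpenPartialHomeomorph M Coord3} {p : M}

theorem isInvertible_coordDiff (hφ : φ ∈ IsManifold.maximalAtlas (𝓡 3) ω M) (hp : p ∈ φ.source) :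
    (coordDiff φ p).IsInvertible := by
  have h : φ.MDifferentiable (𝓡 3) (𝓡 3) :=
    ⟨(contMDiffOn_of_mem_maximalAtlas hφ).mdifferentiableOn (by simp),
      (contMDiffOn_symm_of_mem_maximalAtlas hφ).mdifferentiableOn (by simp)⟩
  exact ⟨h.mfderiv hp, rfl⟩

/-- The vector field on `M` with components `V` in the coordinates `φ`. -/
noncomputable def ofComponents (φ : OpenPartialHomeomorph M Coord3) (V : Coord3 → Coord3) (q : M) :
    TangentSpace (𝓡 3) q :=
  mpullback (𝓡 3) (𝓡 3) φ V q

theorem coordDiff_ofComponents (hφ : φ ∈ IsManifold.maximalAtlas (𝓡 3) ω M) (hp : p ∈ φ.source)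
    (V : Coord3 → Coord3) : coordDiff φ p (ofComponents φ V p) = V (φ p) :=
  (isInvertible_coordDiff hφ hp).self_apply_inverse _

theorem vectorFieldAnalyticAt_ofComponents [IsManifold (𝓡 3) ω M]
    (hφ : φ ∈ IsManifold.maximalAtlas (𝓡 3) ω M)
    (hp : p ∈ φ.source) {V : Coord3 → Coord3} (hV : ContDiffAt ℝ ω V (φ p)) :
    VectorFieldAnalyticAt (ofComponents φ V) p := by
  have := IsManifold.of_le (I := 𝓡 3) (M := M) (m := 1) (n := ω) (by simp)
  refine ContMDiffAt.mpullback_vectorField_preimage (n := ω) ?_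
    (contMDiffAt_of_mem_maximalAtlas hφ hp) (isInvertible_coordDiff hφ hp) (by simp)
  exact contMDiffAt_vectorSpace_iff_contDiffAt.2 hV

/-- Naturality of the bracket under pullback by the chart; on the model space the manifold bracket
is the usual one. -/
theorem coordDiff_mlieBracket [IsManifold (𝓡 3) ω M]
    (hφ : φ ∈ IsManifold.maximalAtlas (𝓡 3) ω M) (hp : p ∈ φ.source)
    {V W : Coord3 → Coord3} (hV : ContDiffAt ℝ ω V (φ p)) (hW : ContDiffAt ℝ ω W (φ p)) :
    coordDiff φ p (mlieBracket (𝓡 3) (ofComponents φ V) (ofComponents φ W) p) =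
      lieBracket ℝ V W (φ p) := by
  have := IsManifold.of_le (I := 𝓡 3) (M := M) (m := minSmoothness ℝ 2) (n := ω) (by simp)
  have hbr := mpullback_mlieBracket (I := 𝓡 3) (I' := 𝓡 3) (n := ω) (f := φ) (x₀ := p)
    ((contMDiffAt_vectorSpace_iff_contDiffAt.2 hV).mdifferentiableAt (by simp))
    ((contMDiffAt_vectorSpace_iff_contDiffAt.2 hW).mdifferentiableAt (by simp))
    (contMDiffAt_of_mem_maximalAtlas hφ hp) (by simp)
  have hflat : mlieBracket (𝓡 3) V W = lieBracket ℝ V W :=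
    (mlieBracketWithin_univ (I := 𝓡 3) (V := V) (W := W)).symm.trans
      (mlieBracketWithin_eq_lieBracketWithin.trans lieBracketWithin_univ)
  exact (congrArg (coordDiff φ p) hbr.symm).trans
    ((coordDiff_ofComponents hφ hp _).trans (congrFun hflat _))

/-- The components of the Nijenhuis torsion in a coordinate system. -/
theorem coordDiff_nijenhuisTorsion [IsManifold (𝓡 3) ω M]
    (hφ : φ ∈ IsManifold.maximalAtlas (𝓡 3) ω M)
    (hp : p ∈ φ.source) {L : (p : M) → TangentSpace (𝓡 3) p →L[ℝ] TangentSpace (𝓡 3) p}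
    {A : Coord3 → Matrix (Fin 3) (Fin 3) ℝ}
    (hL : ∀ q ∈ φ.source, ∀ v : TangentSpace (𝓡 3) q,
      coordDiff φ q (L q v) = Matrix.toEuclideanLin (A (φ q)) (coordDiff φ q v))
    {V W : Coord3 → Coord3} (hV : ContDiffAt ℝ ω V (φ p)) (hW : ContDiffAt ℝ ω W (φ p))
    (hAV : ContDiffAt ℝ ω (fun x => Matrix.toEuclideanLin (A x) (V x)) (φ p))
    (hAW : ContDiffAt ℝ ω (fun x => Matrix.toEuclideanLin (A x) (W x)) (φ p)) :
    coordDiff φ p (nijenhuisTorsion L (ofComponents φ V) (ofComponents φ W) p) =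
      lieBracket ℝ (fun x => Matrix.toEuclideanLin (A x) (V x))
          (fun x => Matrix.toEuclideanLin (A x) (W x)) (φ p)
        + Matrix.toEuclideanLin (A (φ p))
            (Matrix.toEuclideanLin (A (φ p)) (lieBracket ℝ V W (φ p)))
        - Matrix.toEuclideanLin (A (φ p))
            (lieBracket ℝ (fun x => Matrix.toEuclideanLin (A x) (V x)) W (φ p))
        - Matrix.toEuclideanLin (A (φ p))
            (lieBracket ℝ V (fun x => Matrix.toEuclideanLin (A x) (W x)) (φ p)) := by
  -- The matrix describes `L` only on the chart domain, so the fields agree only near `p`; this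
  -- suffices because brackets are local.
  have key : ∀ U : Coord3 → Coord3, (fun q => L q (ofComponents φ U q)) =ᶠ[𝓝 p]
      ofComponents φ (fun x => Matrix.toEuclideanLin (A x) (U x)) := by
    intro U
    filter_upwards [φ.open_source.mem_nhds hp] with q hq
    refine (isInvertible_coordDiff hφ hq).injective ?_
    rw [hL q hq, coordDiff_ofComponents hφ hq, coordDiff_ofComponents hφ hq]
  have hrefl : ∀ U : (q : M) → TangentSpace (𝓡 3) q, U =ᶠ[𝓝 p] U := fun U => EventuallyEq.rfl
  unfold nijenhuisTorsion
  rw [(key V).mlieBracket_vectorField_eq (key W), (key V).mlieBracket_vectorField_eq (hrefl _),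
    (hrefl _).mlieBracket_vectorField_eq (key W)]
  rw [map_sub, map_sub, map_add, hL p hp, hL p hp, hL p hp, hL p hp,
    coordDiff_mlieBracket hφ hp hAV hAW, coordDiff_mlieBracket hφ hp hV hW,
    coordDiff_mlieBracket hφ hp hAV hW, coordDiff_mlieBracket hφ hp hV hAW]

end CoordinateExpressions

/-! ### Calculus in components and the torsion equation for `f`, `g`. -/

theorem fderiv_coord3_apply {V : Coord3 → Coord3} {x : Coord3} (hV : DifferentiableAt ℝ V x)
    (v : Coord3) (i : Fin 3) : fderiv ℝ V x v i = fderiv ℝ (fun y => V y i) x v := by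
  have h := ((EuclideanSpace.proj (𝕜 := ℝ) i : Coord3 →L[ℝ] ℝ).hasFDerivAt.comp x
    hV.hasFDerivAt).fderiv
  exact (congrArg (fun T : Coord3 →L[ℝ] ℝ => T v) h).symm

theorem contDiffAt_coord3 {V : Coord3 → Coord3} {x : Coord3} {n : ℕ∞ω}
    (h : ∀ i, ContDiffAt ℝ n (fun y => V y i) x) : ContDiffAt ℝ n V x :=
  contDiffAt_euclidean.2 h

theorem hasFDerivAt_coord (x : Coord3) (i : Fin 3) :
    HasFDerivAt (fun y : Coord3 => y i) (EuclideanSpace.proj (𝕜 := ℝ) i : Coord3 →L[ℝ] ℝ) x :=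
  (EuclideanSpace.proj (𝕜 := ℝ) i : Coord3 →L[ℝ] ℝ).hasFDerivAt

theorem hasFDerivAt_comp_coords {g : ℝ × ℝ → ℝ} {x : Coord3}
    (hg : DifferentiableAt ℝ g (x 1, x 2)) :
    HasFDerivAt (fun y : Coord3 => g (y 1, y 2)) ((fderiv ℝ g (x 1, x 2)).comp
      ((EuclideanSpace.proj (𝕜 := ℝ) 1 : Coord3 →L[ℝ] ℝ).prod (EuclideanSpace.proj 2))) x :=
  hg.hasFDerivAt.comp (f := fun y : Coord3 => (y 1, y 2)) x
    ((hasFDerivAt_coord x 1).prodMk (hasFDerivAt_coord x 2))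

theorem contDiffAt_comp_coords {g : ℝ × ℝ → ℝ} {x : Coord3} {n : ℕ∞ω}
    (hg : ContDiffAt ℝ n g (x 1, x 2)) :
    ContDiffAt ℝ n (fun y : Coord3 => g (y 1, y 2)) x :=
  hg.comp (f := fun y : Coord3 => (y 1, y 2)) x
    ((EuclideanSpace.proj (𝕜 := ℝ) 1 : Coord3 →L[ℝ] ℝ).contDiff.contDiffAt.prodMk
      (EuclideanSpace.proj (𝕜 := ℝ) 2 : Coord3 →L[ℝ] ℝ).contDiff.contDiffAt)

/-- The action of a semi-normal form on the components of a vector. -/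
theorem toEuclideanLin_semiNormalMatrix (ε : ℝ) (k : ℕ) (lam0 : ℝ) (f g : ℝ × ℝ → ℝ)
    (x v : Coord3) :
    Matrix.toEuclideanLin (semiNormalMatrix ε k lam0 f g x) v =
      !₂[(x 0 + lam0) * v 0, x 1 / k * v 0 + (ε * x 1 ^ k + x 0 + lam0) * v 1,
        f (x 1, x 2) * v 0 + g (x 1, x 2) * v 1 + (ε * x 1 ^ k + x 0 + lam0) * v 2] := by
  ext i
  fin_cases i <;>
    simp [semiNormalMatrix, Matrix.toLpLin_apply, dotProduct, Fin.sum_univ_three]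

open VectorField in
/-- The equation on `f` and `g` expressing that the torsion of a semi-normal form vanishes: only
the component along `∂/∂x³` of its value on `∂/∂x¹, ∂/∂x²` is not identically zero. -/
theorem semiNormalMatrix_structural_equation {M : Type*} [TopologicalSpace M]
    [ChartedSpace Coord3 M] [IsManifold (𝓡 3) ω M]
    {L : (p : M) → TangentSpace (𝓡 3) p →L[ℝ] TangentSpace (𝓡 3) p}
    {e : (p : M) → TangentSpace (𝓡 3) p} (hLe : IsNijenhuisWithUnity L e)
    {φ : OpenPartialHomeomorph M Coord3} (hφ : φ ∈ IsManifold.maximalAtlas (𝓡 3) ω M)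
    {ε lam0 : ℝ} {k : ℕ} (hk : 1 ≤ k) {f g : ℝ × ℝ → ℝ}
    (hform : HasCoordForm L e φ (semiNormalMatrix ε k lam0 f g)) {x : Coord3}
    (hx : x ∈ φ.target) (hf : AnalyticAt ℝ f (x 1, x 2)) (hg : AnalyticAt ℝ g (x 1, x 2)) :
    x 1 * fderiv ℝ g (x 1, x 2) (1, 0) +
      k * (f (x 1, x 2) * fderiv ℝ g (x 1, x 2) (0, 1) -
        g (x 1, x 2) * fderiv ℝ f (x 1, x 2) (0, 1)) + (1 - k) * g (x 1, x 2) = 0 := by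
  have hp : φ.symm x ∈ φ.source := φ.map_target hx
  have hxp : φ (φ.symm x) = x := φ.right_inv hx
  generalize φ.symm x = p at hp hxp
  have hk0 : (k : ℝ) ≠ 0 := by exact_mod_cast (by omega : k ≠ 0)
  -- The torsion is tested on the constant fields `∂₁`, `∂₂`, whose images `AV`, `AW` are the first
  -- two columns of the matrix.
  let V : Coord3 → Coord3 := fun _ => !₂[1, 0, 0]
  let W : Coord3 → Coord3 := fun _ => !₂[0, 1, 0]
  let AV : Coord3 → Coord3 := fun y => !₂[y 0 + lam0, y 1 / k, f (y 1, y 2)]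
  let AW : Coord3 → Coord3 := fun y => !₂[0, ε * y 1 ^ k + y 0 + lam0, g (y 1, y 2)]
  have hAVeq : (fun y => Matrix.toEuclideanLin (semiNormalMatrix ε k lam0 f g y) (V y)) = AV := by
    funext y
    rw [toEuclideanLin_semiNormalMatrix]
    simp [V, AV]
  have hAWeq : (fun y => Matrix.toEuclideanLin (semiNormalMatrix ε k lam0 f g y) (W y)) = AW := by
    funext y
    rw [toEuclideanLin_semiNormalMatrix]
    simp [W, AW]
  have hc : ∀ i : Fin 3, ContDiffAt ℝ ω (fun y : Coord3 => y i) x := fun i =>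
    (EuclideanSpace.proj (𝕜 := ℝ) i : Coord3 →L[ℝ] ℝ).contDiff.contDiffAt
  have hAV : ContDiffAt ℝ ω AV x := by
    refine contDiffAt_coord3 fun i => ?_
    fin_cases i
    · exact (hc 0).add contDiffAt_const
    · exact (hc 1).div_const _
    · exact contDiffAt_comp_coords hf.contDiffAt
  have hAW : ContDiffAt ℝ ω AW x := by
    refine contDiffAt_coord3 fun i => ?_
    fin_cases i
    · exact contDiffAt_const
    · exact ((contDiffAt_const.mul ((hc 1).pow k)).add (hc 0)).add contDiffAt_const
    · exact contDiffAt_comp_coords hg.contDiffAt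
  have hV : ContDiffAt ℝ ω V x := contDiffAt_const
  have hW : ContDiffAt ℝ ω W x := contDiffAt_const
  have htor := coordDiff_nijenhuisTorsion hφ hp (fun q hq => (hform q hq).2) (hxp.symm ▸ hV)
    (hxp.symm ▸ hW) (by rw [hAVeq, hxp]; exact hAV) (by rw [hAWeq, hxp]; exact hAW)
  rw [hLe.torsion_eq_zero p _ _ (vectorFieldAnalyticAt_ofComponents hφ hp (hxp.symm ▸ hV))
    (vectorFieldAnalyticAt_ofComponents hφ hp (hxp.symm ▸ hW)), map_zero, hAVeq, hAWeq, hxp] at htor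
  have hdAV := hAV.differentiableAt (by simp)
  have hdAW := hAW.differentiableAt (by simp)
  have hV0 : ∀ v, fderiv ℝ V x v = 0 := fun v => by simp [V]
  have hW0 : ∀ v, fderiv ℝ W x v = 0 := fun v => by simp [W]
  have a0 : ∀ v, fderiv ℝ AV x v 0 = v 0 := fun v => by
    rw [fderiv_coord3_apply hdAV]
    exact congrArg (fun T : Coord3 →L[ℝ] ℝ => T v) ((hasFDerivAt_coord x 0).add_const lam0).fderiv
  have a1 : ∀ v, fderiv ℝ AV x v 1 = (k : ℝ)⁻¹ * v 1 := fun v => by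
    rw [fderiv_coord3_apply hdAV]
    have := ((hasFDerivAt_coord x 1).const_mul (k : ℝ)⁻¹).fderiv
    simp only [AV, div_eq_inv_mul]
    exact congrArg (fun T : Coord3 →L[ℝ] ℝ => T v) this
  have a2 : ∀ v, fderiv ℝ AV x v 2 = v 1 * fderiv ℝ f (x 1, x 2) (1, 0) +
      v 2 * fderiv ℝ f (x 1, x 2) (0, 1) := fun v => by
    rw [fderiv_coord3_apply hdAV, ← apply_eq_partials]
    exact congrArg (fun T : Coord3 →L[ℝ] ℝ => T v)
      (hasFDerivAt_comp_coords hf.differentiableAt).fderiv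
  have b0 : ∀ v, fderiv ℝ AW x v 0 = 0 := fun v => by
    rw [fderiv_coord3_apply hdAW]
    exact congrArg (fun T : Coord3 →L[ℝ] ℝ => T v) (hasFDerivAt_const (0 : ℝ) x).fderiv
  have b1 : ∀ v, fderiv ℝ AW x v 1 = ε * (k * x 1 ^ (k - 1) * v 1) + v 0 := fun v => by
    rw [fderiv_coord3_apply hdAW]
    have := (((((hasFDerivAt_coord x 1).pow k).const_mul ε).add
      (hasFDerivAt_coord x 0)).add_const lam0).fderiv
    refine (congrArg (fun T : Coord3 →L[ℝ] ℝ => T v) this).trans ?_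
    simp
  have b2 : ∀ v, fderiv ℝ AW x v 2 = v 1 * fderiv ℝ g (x 1, x 2) (1, 0) +
      v 2 * fderiv ℝ g (x 1, x 2) (0, 1) := fun v => by
    rw [fderiv_coord3_apply hdAW, ← apply_eq_partials]
    exact congrArg (fun T : Coord3 →L[ℝ] ℝ => T v)
      (hasFDerivAt_comp_coords hg.differentiableAt).fderiv
  have h2 := congrArg (fun v : Coord3 => v 2) htor
  simp only [toEuclideanLin_semiNormalMatrix, lieBracket, hV0, hW0, PiLp.sub_apply,
    PiLp.add_apply, a0, a1, a2, b0, b1, b2] at h2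
  simp [V, W, AV, AW] at h2
  field_simp at h2
  linear_combination -h2

/-! ### The change of the third coordinate. -/

/-- The change of variables `(x¹, x², x³) ↦ (x¹, x², Z(x², x³))`. -/
noncomputable def replaceThird (Z : ℝ × ℝ → ℝ) (x : Coord3) : Coord3 :=
  !₂[x 0, x 1, Z (x 1, x 2)]

theorem contDiffAt_replaceThird {Z : ℝ × ℝ → ℝ} {x : Coord3} (hZ : AnalyticAt ℝ Z (x 1, x 2)) :
    ContDiffAt ℝ ω (replaceThird Z) x := by
  refine contDiffAt_coord3 fun i => ?_
  fin_cases i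
  · exact (EuclideanSpace.proj (𝕜 := ℝ) 0 : Coord3 →L[ℝ] ℝ).contDiff.contDiffAt
  · exact (EuclideanSpace.proj (𝕜 := ℝ) 1 : Coord3 →L[ℝ] ℝ).contDiff.contDiffAt
  · exact contDiffAt_comp_coords hZ.contDiffAt

theorem fderiv_replaceThird {Z : ℝ × ℝ → ℝ} {x : Coord3} (hZ : AnalyticAt ℝ Z (x 1, x 2))
    (v : Coord3) : fderiv ℝ (replaceThird Z) x v =
      !₂[v 0, v 1, v 1 * fderiv ℝ Z (x 1, x 2) (1, 0) + v 2 * fderiv ℝ Z (x 1, x 2) (0, 1)] := by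
  have hd := (contDiffAt_replaceThird hZ).differentiableAt (by simp)
  ext i
  rw [fderiv_coord3_apply hd]
  fin_cases i
  · exact congrArg (fun T : Coord3 →L[ℝ] ℝ => T v) (hasFDerivAt_coord x 0).fderiv
  · exact congrArg (fun T : Coord3 →L[ℝ] ℝ => T v) (hasFDerivAt_coord x 1).fderiv
  · exact (congrArg (fun T : Coord3 →L[ℝ] ℝ => T v)
      (hasFDerivAt_comp_coords hZ.differentiableAt).fderiv).trans (apply_eq_partials _ _ _)

/-- Where `∂Z/∂x³ ≠ 0`, the map `replaceThird Z` is a local analytic diffeomorphism. -/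
theorem exists_openPartialHomeomorph_replaceThird {Z : ℝ × ℝ → ℝ} {x : Coord3}
    (hZ : AnalyticAt ℝ Z (x 1, x 2)) (hZ₂ : fderiv ℝ Z (x 1, x 2) (0, 1) ≠ 0) :
    ∃ Θ : OpenPartialHomeomorph Coord3 Coord3, ⇑Θ = replaceThird Z ∧ x ∈ Θ.source ∧
      ContDiffOn ℝ ω Θ Θ.source ∧ ContDiffOn ℝ ω Θ.symm Θ.target := by
  have hc := contDiffAt_replaceThird hZ
  -- The Jacobian is triangular with diagonal `1, 1, Z₃`.
  have hinj : Function.Injective (fderiv ℝ (replaceThird Z) x : Coord3 →ₗ[ℝ] Coord3) := by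
    refine (injective_iff_map_eq_zero _).2 fun v hv => ?_
    have hv' : fderiv ℝ (replaceThird Z) x v = 0 := hv
    rw [fderiv_replaceThird hZ] at hv'
    have h0 : v 0 = 0 := congrArg (fun w : Coord3 => w 0) hv'
    have h1 : v 1 = 0 := congrArg (fun w : Coord3 => w 1) hv'
    have h2 := congrArg (fun w : Coord3 => w 2) hv'
    have h2' : v 2 = 0 := by simpa [h1, hZ₂] using h2
    ext i
    fin_cases i
    · exact h0
    · exact h1
    · exact h2'
  let D : Coord3 ≃L[ℝ] Coord3 := (LinearEquiv.ofInjectiveEndo _ hinj).toContinuousLinearEquiv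
  have hD : HasFDerivAt (replaceThird Z) (D : Coord3 →L[ℝ] Coord3) x :=
    (hc.differentiableAt (by simp)).hasFDerivAt
  let T := hc.toOpenPartialHomeomorph _ hD (by simp)
  -- The restriction keeps the points where both the map and its local inverse are analytic.
  refine ⟨T.restrContDiff ℝ ω (by simp), rfl,
    ⟨hc.mem_toOpenPartialHomeomorph_source hD (by simp), hc, hc.to_localInverse hD (by simp)⟩,
    T.contDiffOn_restrContDiff_source _ _, T.contDiffOn_restrContDiff_target _ _⟩

/-- Composing a chart of the maximal atlas with an analytic change of variables. -/
theorem trans_mem_maximalAtlas {M : Type*} [TopologicalSpace M] [ChartedSpace Coord3 M]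
    [IsManifold (𝓡 3) ω M] {φ : OpenPartialHomeomorph M Coord3}
    (hφ : φ ∈ IsManifold.maximalAtlas (𝓡 3) ω M) {Θ : OpenPartialHomeomorph Coord3 Coord3}
    (hΘ : ContDiffOn ℝ ω Θ Θ.source) (hΘ' : ContDiffOn ℝ ω Θ.symm Θ.target) :
    φ.trans Θ ∈ IsManifold.maximalAtlas (𝓡 3) ω M := by
  refine OpenPartialHomeomorph.mem_maximalAtlas_of_contMDiffOn _ ?_ ?_
  · exact hΘ.contMDiffOn.comp' (contMDiffOn_of_mem_maximalAtlas hφ)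
  · exact (contMDiffOn_symm_of_mem_maximalAtlas hφ).comp' hΘ'.contMDiffOn

/-- A function with `g Z_{x³} = 1` and `x² Z_{x²} + k f Z_{x³} = (1 - k) Z`, used as the new third
coordinate, brings a semi-normal form to the normal form. -/
theorem HasCoordForm.trans_replaceThird {M : Type*} [TopologicalSpace M]
    [ChartedSpace Coord3 M] [IsManifold (𝓡 3) ω M]
    {L : (p : M) → TangentSpace (𝓡 3) p →L[ℝ] TangentSpace (𝓡 3) p}
    {e : (p : M) → TangentSpace (𝓡 3) p} {φ : OpenPartialHomeomorph M Coord3}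
    (hφ : φ ∈ IsManifold.maximalAtlas (𝓡 3) ω M) {ε lam0 : ℝ} {k : ℕ} (hk : 1 ≤ k)
    {f g Z : ℝ × ℝ → ℝ} (hform : HasCoordForm L e φ (semiNormalMatrix ε k lam0 f g))
    {Θ : OpenPartialHomeomorph Coord3 Coord3} (hΘ : ⇑Θ = replaceThird Z)
    (hZ : ∀ x ∈ Θ.source, AnalyticAt ℝ Z (x 1, x 2) ∧
      g (x 1, x 2) * fderiv ℝ Z (x 1, x 2) (0, 1) = 1 ∧
      x 1 * fderiv ℝ Z (x 1, x 2) (1, 0) + k * f (x 1, x 2) * fderiv ℝ Z (x 1, x 2) (0, 1) =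
        (1 - k) * Z (x 1, x 2)) :
    HasCoordForm L e (φ.trans Θ)
      (semiNormalMatrix ε k lam0 (fun y => (1 - (k : ℝ)) / k * y.2) (fun _ => 1)) := by
  intro p hp
  have hk0 : (k : ℝ) ≠ 0 := by exact_mod_cast (by omega : k ≠ 0)
  rw [OpenPartialHomeomorph.trans_source] at hp
  obtain ⟨hpφ, hpΘ⟩ := hp
  obtain ⟨hZa, hZ1, hZ2⟩ := hZ _ hpΘ
  obtain ⟨he, hL⟩ := hform p hpφ
  have hψ : (φ.trans Θ : M → Coord3) = replaceThird Z ∘ φ := by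
    rw [OpenPartialHomeomorph.coe_trans, hΘ]
  have hd : ∀ v : TangentSpace (𝓡 3) p,
      coordDiff (φ.trans Θ) p v = fderiv ℝ (replaceThird Z) (φ p) (coordDiff φ p v) := by
    intro v
    have h1 : MDifferentiableAt (𝓡 3) (𝓡 3) (replaceThird Z) (φ p) :=
      ((contDiffAt_replaceThird hZa).differentiableAt (by simp)).mdifferentiableAt
    have h2 : MDifferentiableAt (𝓡 3) (𝓡 3) φ p :=
      (contMDiffAt_of_mem_maximalAtlas hφ hpφ).mdifferentiableAt (by simp)
    have h3 := mfderiv_comp p h1 h2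
    rw [mfderiv_eq_fderiv] at h3
    unfold coordDiff
    rw [hψ, h3]
    rfl
  have hval : (φ.trans Θ) p = replaceThird Z (φ p) := congrFun hψ p
  refine ⟨?_, fun v => ?_⟩
  · rw [hd, he, fderiv_replaceThird hZa]
    ext i
    fin_cases i <;> simp
  · rw [hd, hd, hL, hval, toEuclideanLin_semiNormalMatrix, toEuclideanLin_semiNormalMatrix,
      fderiv_replaceThird hZa, fderiv_replaceThird hZa]
    generalize coordDiff φ p v = w
    ext i
    fin_cases i
    · simp [replaceThird]
    · simp [replaceThird]
    · simp [replaceThird]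
      field_simp
      -- The first two entries of the third row give the two equations for `Z`; the eigenvalue terms
      -- cancel.
      linear_combination w 0 * hZ2 + k * w 1 * hZ1

/-! ### Assembly of the chart. -/

theorem mainTheorem7 {M : Type*} [TopologicalSpace M] [ChartedSpace Coord3 M]
    [IsManifold (𝓡 3) ω M]
    (L : (p : M) → TangentSpace (𝓡 3) p →L[ℝ] TangentSpace (𝓡 3) p)
    (e : (p : M) → TangentSpace (𝓡 3) p) (hLe : IsNijenhuisWithUnity L e)
    (p₀ : M) (ε : ℝ) (hε : ε = 1 ∨ ε = -1) (k : ℕ) (hk : 1 ≤ k) (lam0 : ℝ)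
    (f g : ℝ × ℝ → ℝ) (hf : AnalyticAt ℝ f (0, 0)) (hg : AnalyticAt ℝ g (0, 0))
    (φ : OpenPartialHomeomorph M Coord3)
    (hφ : φ ∈ IsManifold.maximalAtlas (𝓡 3) ω M)
    (hp₀ : p₀ ∈ φ.source) (hφ₀ : φ p₀ = 0)
    (hform : HasCoordForm L e φ (semiNormalMatrix ε k lam0 f g))
    (hg₀ : g (0, 0) ≠ 0) (hf₀ : k = 1 → f (0, 0) = 0) :
    ∃ ψ ∈ IsManifold.maximalAtlas (𝓡 3) ω M,
      p₀ ∈ ψ.source ∧ ψ p₀ 0 = 0 ∧ ψ p₀ 1 = 0 ∧ (f (0, 0) = 0 → ψ p₀ 2 = 0) ∧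
      HasCoordForm L e ψ
        (semiNormalMatrix ε k lam0 (fun y => (1 - (k : ℝ)) / k * y.2) (fun _ => 1)) := by
  -- As `f` and `g` do not involve `x¹`, their equation can be read off on the slice `x¹ = 0`.
  have htarget : ∀ᶠ y : ℝ × ℝ in 𝓝 (0, 0), (!₂[0, y.1, y.2] : Coord3) ∈ φ.target := by
    have hcont : Continuous fun y : ℝ × ℝ => (!₂[0, y.1, y.2] : Coord3) := by fun_prop
    refine hcont.continuousAt (φ.open_target.mem_nhds ?_)
    have h0 : (!₂[0, 0, 0] : Coord3) = 0 := by
      ext i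
      fin_cases i <;> rfl
    exact h0 ▸ hφ₀ ▸ φ.map_source hp₀
  obtain ⟨Z, hZ, hZ₀, hZe⟩ := exists_analyticAt_rectifying hk hf hg hg₀ hf₀ (by
    filter_upwards [htarget, hf.eventually_analyticAt, hg.eventually_analyticAt] with y h1 h2 h3
    exact semiNormalMatrix_structural_equation hLe hφ hk hform h1 h2 h3)
  have hproj : Tendsto (fun x : Coord3 => (x 1, x 2)) (𝓝 0) (𝓝 (0, 0)) := by
    have hcont : Continuous fun x : Coord3 => (x 1, x 2) := by fun_prop
    exact hcont.tendsto 0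
  -- The coordinate form is required on the whole domain of the new chart, so the chart is shrunk to
  -- a set where the equations for `Z` hold.
  obtain ⟨U, hUZ, hUo, hU0⟩ := eventually_nhds_iff.1
    (hproj.eventually (hZ.eventually_analyticAt.and hZe))
  obtain ⟨Θ, hΘ, hΘ0, hΘa, hΘa'⟩ := exists_openPartialHomeomorph_replaceThird (x := 0) hZ
    (right_ne_zero_of_mul_eq_one hZe.self_of_nhds.1)
  have hΘU : (Θ.restrOpen U hUo).source = Θ.source ∩ U := Θ.restrOpen_source U hUo
  have hval : φ.trans (Θ.restrOpen U hUo) p₀ = replaceThird Z 0 := by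
    rw [← hΘ, ← hφ₀]
    rfl
  refine ⟨φ.trans (Θ.restrOpen U hUo), trans_mem_maximalAtlas hφ ?_ ?_, ?_, ?_, ?_, ?_, ?_⟩
  · exact hΘa.mono (hΘU ▸ Set.inter_subset_left)
  · exact hΘa'.mono fun y hy => hy.1
  · rw [OpenPartialHomeomorph.trans_source]
    refine ⟨hp₀, ?_⟩
    rw [Set.mem_preimage, hφ₀, hΘU]
    exact ⟨hΘ0, hU0⟩
  · rw [hval]
    rfl
  · rw [hval]
    rfl
  · intro h
    rw [hval]
    exact hZ₀ h
  · exact hform.trans_replaceThird hφ hk hΘ fun x hx => hUZ x (hΘU ▸ hx).2
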